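/- Let $\mathcal M\subseteq B(\mathcal H)$ and $\mathcal N\subseteq B(\mathcal K)$ be von Neumann algebras on Hilbert spaces $\mathcal H,\mathcal K$, equipped with normal, faithful tracial states $\tau:\mathcal M\to\mathbb C$ and $\tau':\mathcal N\to\mathbb C$ respectively. Let $\phi:\mathcal M\to\mathcal N$ be a strictly CPTP map: a completely positive linear map with $\tau'(\phi(X))=\tau(X)$ for all $X\in\mathcal M$, which maps positive invertible elements to positive invertible elements. For $p\ge 1$ with $\frac1p+\frac1q=1$, write $\|X\|_p=\tau(|X|^p)^{1/p}$, and for a positive invertible $B\in\mathcal M$ let $\|X\|_{B,p}=\|B^{-1/2q}XB^{-1/2q}\|_p$ be the Araki–Masuda $p$-norm of $X\in\mathcal M$; similarly on $\mathcal N$, with $\tau'$ in place of $\tau$. In particular $\|X\|_{B,2}=\|B^{-1/4}XB^{-1/4}\|_2$. Let $B\in\mathcal M$ be positive and invertible with $\tau(B)=1$. Then for all $X\in\mathcal M$, $$\|\phi(X)\|_{\phi(B),2}\le\|X\|_{B,2}.$$ -/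

import Mathlib

open scoped CStarAlgebra

/-! ### A von Neumann algebra as an ordered C⋆-algebra -/

/-- A von Neumann algebra is norm closed, so (Mathlib) its elements form a C⋆-algebra. -/
instance VonNeumannAlgebra.isClosed_toStarSubalgebra {H : Type*} [NormedAddCommGroup H]
    [InnerProductSpace ℂ H] [CompleteSpace H] (M : VonNeumannAlgebra H) :
    IsClosed (M.toStarSubalgebra : Set (H →L[ℂ] H)) := by
  have h : (M.toStarSubalgebra : Set (H →L[ℂ] H)) =
      Set.centralizer (Set.centralizer (M : Set (H →L[ℂ] H))) := by simp
  rw [h]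
  exact Set.isClosed_centralizer _

/-- The order on `M` inherited from the Loewner order of bounded operators makes `M` a star-ordered
ring: the nonnegative elements are those of the form `s⋆ s` with `s` in `M`. -/
instance VonNeumannAlgebra.instStarOrderedRing {H : Type*} [NormedAddCommGroup H]
    [InnerProductSpace ℂ H] [CompleteSpace H] (M : VonNeumannAlgebra H) :
    StarOrderedRing M.toStarSubalgebra := by
  refine StarOrderedRing.of_nonneg_iff' (fun {x y} h z => ?_) (fun x => ⟨fun h => ?_, ?_⟩)
  · exact add_le_add_right (α := H →L[ℂ] H) h z
  · have hx : (0 : H →L[ℂ] H) ≤ (x : H →L[ℂ] H) := h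
    have hmem : CFC.sqrt (x : H →L[ℂ] H) ∈ M.toStarSubalgebra := by
      have h1 : CFC.sqrt (x : H →L[ℂ] H) ∈
          Set.centralizer (Set.centralizer (M : Set (H →L[ℂ] H))) := by
        intro c hc
        have hcomm : Commute (x : H →L[ℂ] H) c := hc _ x.2
        rw [CFC.sqrt_eq_cfc]
        exact (hcomm.cfc_nnreal _).symm.eq
      rw [VonNeumannAlgebra.centralizer_centralizer] at h1
      exact h1
    refine ⟨⟨_, hmem⟩, Subtype.ext ?_⟩
    change (x : H →L[ℂ] H) = star (CFC.sqrt (x : H →L[ℂ] H)) * CFC.sqrt (x : H →L[ℂ] H)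
    rw [(CFC.sqrt_nonneg (x : H →L[ℂ] H)).isSelfAdjoint.star_eq, CFC.sqrt_mul_sqrt_self _ hx]
  · rintro ⟨s, rfl⟩
    change (0 : H →L[ℂ] H) ≤ star (s : H →L[ℂ] H) * (s : H →L[ℂ] H)
    exact star_mul_self_nonneg _

/-! ### Traces, channels and norms -/

open scoped ComplexOrder in
/-- `τ` is a normal, faithful tracial state on the von Neumann algebra `M`. Normality is
preservation of suprema of directed families of positive elements. -/
structure IsNormalFaithfulTracialState {H : Type*} [NormedAddCommGroup H] [InnerProductSpace ℂ H]
    [CompleteSpace H] (M : VonNeumannAlgebra H) (τ : M.toStarSubalgebra →ₗ[ℂ] ℂ) : Prop where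
  nonneg : ∀ x : M.toStarSubalgebra, 0 ≤ x → 0 ≤ τ x
  map_one : τ 1 = 1
  tracial : ∀ x y : M.toStarSubalgebra, τ (x * y) = τ (y * x)
  faithful : ∀ x : M.toStarSubalgebra, 0 ≤ x → τ x = 0 → x = 0
  normal : ∀ (S : Set M.toStarSubalgebra) (x : M.toStarSubalgebra), S.Nonempty →
    DirectedOn (· ≤ ·) S → (∀ s ∈ S, 0 ≤ s) → IsLUB S x →
    IsLUB ((fun s => (τ s).re) '' S) (τ x).re

/-- The completely positive map `φ` is strictly CPTP: it preserves the traces and maps positive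
invertible elements to positive invertible elements. -/
structure IsStrictlyCPTP {H K : Type*} [NormedAddCommGroup H] [InnerProductSpace ℂ H]
    [CompleteSpace H] [NormedAddCommGroup K] [InnerProductSpace ℂ K] [CompleteSpace K]
    {M : VonNeumannAlgebra H} {N : VonNeumannAlgebra K}
    (τ : M.toStarSubalgebra →ₗ[ℂ] ℂ) (τ' : N.toStarSubalgebra →ₗ[ℂ] ℂ)
    (φ : M.toStarSubalgebra →CP N.toStarSubalgebra) : Prop where
  trace_preserving : ∀ x : M.toStarSubalgebra, τ' (φ x) = τ x
  strict : ∀ x : M.toStarSubalgebra, 0 ≤ x → IsUnit x → 0 ≤ φ x ∧ IsUnit (φ x)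

/-- The tracial `p`-norm `‖X‖_p = τ(|X|^p)^(1/p)` of an element of `M` (`τ(|X|^p)` is a nonnegative
real number, so that taking the real part loses nothing). -/
noncomputable def tracialNorm {H : Type*} [NormedAddCommGroup H] [InnerProductSpace ℂ H]
    [CompleteSpace H] {M : VonNeumannAlgebra H} (τ : M.toStarSubalgebra →ₗ[ℂ] ℂ) (p : ℝ)
    (X : M.toStarSubalgebra) : ℝ :=
  (τ (CFC.rpow (CFC.abs X) p)).re ^ (1 / p)

/-- The Araki–Masuda `p`-norm `‖X‖_{B,p} = ‖B^{-1/(2q)} X B^{-1/(2q)}‖_p` on `M`, for a positive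
invertible `B`, where `1/p + 1/q = 1`. -/
noncomputable def arakiMasudaNorm {H : Type*} [NormedAddCommGroup H] [InnerProductSpace ℂ H]
    [CompleteSpace H] {M : VonNeumannAlgebra H} (τ : M.toStarSubalgebra →ₗ[ℂ] ℂ)
    (B : M.toStarSubalgebra) (p : ℝ) (X : M.toStarSubalgebra) : ℝ :=
  tracialNorm τ p (CFC.rpow B (-(1 / (2 * Real.conjExponent p))) * X *
    CFC.rpow B (-(1 / (2 * Real.conjExponent p))))

/-! ### Kadison–Schwarz inequality via 2×2 matrices. -/

section CompletelyPositive

variable {A A' : Type*} [CStarAlgebra A] [PartialOrder A] [StarOrderedRing A]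
  [CStarAlgebra A'] [PartialOrder A'] [StarOrderedRing A']

/-! The squared norm is the form `τ(x⋆ B^(-1/2) x B^(-1/2))`. For the one-sided form `τ(w⋆ B⁻¹ w)`
monotonicity is Kadison–Schwarz plus trace preservation (`CompletelyPositiveMap.star_mul_mul_le`).
The symmetric form follows by interpolation (`re_trace_le_of_expSMul`): with `s = φ(B)^(-1/2)`, the
entire function `F(z) = τ'(φ(B^z x⋆ B^(-z)) s φ(B^z x B^(-z)) s)` has the wanted left side as
`F(0)`. On `Re z = ±1/4`, Cauchy–Schwarz and the one-sided inequality bound `|F|` by the form of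
`x`, so the three lines theorem bounds `F(0)` too. -/

theorem CStarMatrix.apply_self_nonneg {n : Type*} [Fintype n] {P : CStarMatrix n n A}
    (hP : 0 ≤ P) (i : n) : 0 ≤ P i i := by
  rw [StarOrderedRing.nonneg_iff] at hP
  induction hP using AddSubmonoid.closure_induction with
  | mem x hx =>
    obtain ⟨D, rfl⟩ := hx
    change 0 ≤ (star D * D) i i
    rw [CStarMatrix.mul_apply]
    exact Finset.sum_nonneg fun k _ => star_mul_self_nonneg (D k i)
  | zero => exact le_rfl
  | add x y _ _ hx hy => exact add_nonneg hx hy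

/-- The Kadison–Schwarz inequality `φ(x)⋆ φ(r²)⁻¹ φ(x) ≤ φ(x⋆ r⁻² x)`. -/
theorem CompletelyPositiveMap.star_mul_mul_le (φ : A →CP A') {r r' : A} {t : A'}
    (hr : star r = r) (hr' : star r' = r') (hrr : r * r' = 1)
    (ht : star t = t) (htr : t * φ (r * r) = 1) (x : A) :
    star (φ x) * t * φ x ≤ φ (star x * (r' * r') * x) := by
  have hrr' : r' * r = 1 := by simpa [hr, hr'] using congrArg star hrr
  -- `P⋆P` has rows `(r², x)` and `(x⋆, x⋆ r'² x)`. Conjugating its image under `φ` by `C` leaves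
  -- the Schur complement in the lower right corner.
  let P : CStarMatrix (Fin 2) (Fin 2) A := CStarMatrix.ofMatrix !![r, r' * x; 0, 0]
  let C : CStarMatrix (Fin 2) (Fin 2) A' := CStarMatrix.ofMatrix !![0, -(t * φ x); 0, 1]
  have h := φ.map_cstarMatrix_nonneg _ (star_mul_self_nonneg P)
  have h' := CStarMatrix.apply_self_nonneg (star_left_conjugate_nonneg h C) 1
  have e1 : r * (r' * x) = x := by rw [← mul_assoc, hrr, one_mul]
  have e2 : star x * (r' * r) = star x := by rw [hrr', mul_one]
  have e3 (y : A') : t * (φ (r * r) * y) = y := by rw [← mul_assoc, htr, one_mul]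
  simp [P, C, CStarMatrix.mul_apply, CStarMatrix.star_apply, hr, hr', ht, e1, e2, e3, map_star,
    mul_assoc, add_mul] at h'
  simpa [mul_assoc] using h'

end CompletelyPositive

/-! ### Cauchy–Schwarz for a positive functional. -/

section Trace

variable {A : Type*} [CStarAlgebra A] [PartialOrder A] [StarOrderedRing A]

open scoped ComplexOrder in
-- Cauchy–Schwarz in arithmetic-mean form, which suffices because both terms will share one bound. A
-- phase `c` rotates `τ(ab)` onto the positive axis, and `τ` is nonnegative on the square of `a⋆ -
-- cb`.
theorem norm_trace_mul_le {τ : A →ₗ[ℂ] ℂ} (hτ : ∀ x, 0 ≤ x → 0 ≤ τ x) (a b : A) :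
    ‖τ (a * b)‖ ≤ ((τ (a * star a)).re + (τ (star b * b)).re) / 2 := by
  have hτc (x : A) : τ (star x) = star (τ x) := map_star (PositiveLinearMap.mk₀ τ hτ) x
  obtain ⟨c, hc, hc'⟩ : ∃ c : ℂ, ‖c‖ = 1 ∧ c * τ (a * b) = ‖τ (a * b)‖ := by
    by_cases h0 : τ (a * b) = 0
    · exact ⟨1, by simp, by simp [h0]⟩
    · have hn : (‖τ (a * b)‖ : ℂ) ≠ 0 := by simpa using h0
      exact ⟨‖τ (a * b)‖ / τ (a * b), by simp [h0], div_mul_cancel₀ _ h0⟩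
  have h := (Complex.le_def.1 (hτ _ (star_mul_self_nonneg (star a - c • b)))).1
  have e : star (star a - c • b) * (star a - c • b) =
      a * star a + star b * b - (c • (a * b) + star (c • (a * b))) := by
    have hcc : c * star c = 1 := by
      simp [Complex.mul_conj, Complex.normSq_eq_norm_sq, hc]
    simp only [star_sub, star_star, star_smul, star_mul, sub_mul, mul_sub, smul_mul_assoc,
      mul_smul_comm, smul_sub, smul_smul, hcc, one_smul]
    abel
  rw [e, map_sub, map_add, map_add, hτc, map_smul, smul_eq_mul, hc'] at h
  simp at h
  linarith

end Trace

/-! ### Complex powers as an entire one-parameter group. -/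

section Exp

variable {A : Type*} [CStarAlgebra A]

/-- The one-parameter group `z ↦ exp (z l)`. -/
noncomputable def expSMul (l : A) (z : ℂ) : A := NormedSpace.exp (z • l)

theorem expSMul_add (l : A) (z w : ℂ) : expSMul l (z + w) = expSMul l z * expSMul l w := by
  let := NormedAlgebra.restrictScalars ℚ ℂ A
  rw [expSMul, add_smul]
  exact NormedSpace.exp_add_of_commute (((Commute.refl l).smul_left z).smul_right w)

@[simp] theorem expSMul_zero (l : A) : expSMul l 0 = 1 := by simp [expSMul]

theorem star_expSMul {l : A} (hl : IsSelfAdjoint l) (z : ℂ) :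
    star (expSMul l z) = expSMul l (star z) := by
  rw [expSMul, expSMul, NormedSpace.star_exp, star_smul, hl.star_eq]

theorem differentiable_expSMul (l : A) : Differentiable ℂ (expSMul l) :=
  differentiable_exp_smul_const ℂ l

theorem norm_expSMul_sq {l : A} (hl : IsSelfAdjoint l) (z : ℂ) :
    ‖expSMul l z‖ * ‖expSMul l z‖ = ‖expSMul l (2 * z.re : ℝ)‖ := by
  rw [← CStarRing.norm_star_mul_self, star_expSMul hl, ← expSMul_add]
  congr 2
  apply Complex.ext <;> simp [two_mul]

theorem exists_norm_expSMul_le {l : A} (hl : IsSelfAdjoint l) (r : ℝ) :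
    ∃ C, ∀ z : ℂ, |z.re| ≤ r → ‖expSMul l z‖ ≤ C := by
  have hc : Continuous fun x : ℝ => ‖expSMul l (2 * x : ℝ)‖ :=
    ((differentiable_expSMul l).continuous.comp
      (Complex.continuous_ofReal.comp (continuous_const.mul continuous_id))).norm
  obtain ⟨C, hC⟩ := (isCompact_Icc (a := -r) (b := r)).bddAbove_image hc.continuousOn
  -- `C` bounds the squared norm, and `n² ≤ C` gives `n ≤ C + 1`.
  refine ⟨C + 1, fun z hz => ?_⟩
  have h := hC (Set.mem_image_of_mem _ (abs_le.1 hz))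
  rw [← norm_expSMul_sq hl] at h
  nlinarith [norm_nonneg (expSMul l z), sq_nonneg (‖expSMul l z‖ - 1)]

variable [PartialOrder A] [StarOrderedRing A]

theorem CFC.rpow_eq_expSMul_log {b : A} (hb : IsStrictlyPositive b) (r : ℝ) :
    CFC.rpow b r = expSMul (CFC.log b) r := by
  have hs : ∀ x ∈ spectrum ℝ b, 0 < x := fun x hx => hb.spectrum_pos hx
  have h0 : ∀ x ∈ spectrum ℝ b, x ≠ 0 := fun x hx => (hs x hx).ne'
  have hc : ContinuousOn Real.log (spectrum ℝ b) := by fun_prop (disch := assumption)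
  have e : (r : ℂ) • CFC.log b = cfc (fun x => r * Real.log x) b := by
    rw [Complex.coe_smul, CFC.log, ← cfc_smul ..]; rfl
  rw [CFC.rpow_eq_pow, CFC.rpow_eq_cfc_real hb.nonneg, expSMul, e,
    ← CFC.real_exp_eq_normedSpace_exp (cfc_predicate _ b), ← cfc_comp' Real.exp _ b]
  refine cfc_congr fun x hx => ?_
  rw [Real.rpow_def_of_pos (hs x hx), mul_comm]

end Exp

/-! ### Interpolation on the strip `|Re z| ≤ 1/4`. -/

section Contraction

variable {A A' : Type*} [CStarAlgebra A] [PartialOrder A] [StarOrderedRing A]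
  [CStarAlgebra A'] [PartialOrder A'] [StarOrderedRing A']

open scoped ComplexOrder in
/-- The quadratic form `x ↦ τ (x⋆ b^(-1/2) x b^(-1/2))` is monotone under trace-preserving
completely positive maps. Here `b = exp l` and `s` is a self-adjoint fourth root of `φ(b)⁻¹`. -/
theorem re_trace_le_of_expSMul {τ : A →ₗ[ℂ] ℂ} {τ' : A' →ₗ[ℂ] ℂ}
    (hτt : ∀ x y, τ (x * y) = τ (y * x))
    (hτ' : ∀ x, 0 ≤ x → 0 ≤ τ' x) (hτt' : ∀ x y, τ' (x * y) = τ' (y * x))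
    (φ : A →CP A') (hφ : ∀ x, τ' (φ x) = τ x) {l : A} (hl : IsSelfAdjoint l) {s : A'}
    (hs : IsSelfAdjoint s) (hsl : s * s * φ (expSMul l 1) = 1) (x : A) :
    (τ' (star (φ x) * s * φ x * s)).re ≤
      (τ (star x * expSMul l (-(1 / 2)) * x * expSMul l (-(1 / 2)))).re := by
  set γ := (τ (star x * expSMul l (-(1 / 2)) * x * expSMul l (-(1 / 2)))).re with hγ
  have hφc : Continuous φ := map_continuous φ
  have hτc : Continuous τ' := map_continuous (PositiveLinearMap.mk₀ τ' hτ')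
  -- The form of `s * s` is dominated, by the Kadison–Schwarz inequality.
  have hQ (w : A) : (τ' (star (φ w) * (s * s) * φ w)).re ≤
      (τ (star w * expSMul l (-1) * w)).re := by
    have h1 : expSMul l (1 / 2) * expSMul l (1 / 2) = expSMul l 1 := by
      rw [← expSMul_add]; norm_num
    have h2 : expSMul l (-(1 / 2)) * expSMul l (-(1 / 2)) = expSMul l (-1) := by
      rw [← expSMul_add]; norm_num
    have h := φ.star_mul_mul_le (r := expSMul l (1 / 2)) (r' := expSMul l (-(1 / 2))) (t := s * s)
      (by rw [star_expSMul hl]; simp) (by rw [star_expSMul hl]; simp)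
      (by rw [← expSMul_add]; simp) (by rw [star_mul, hs.star_eq]) (by rw [h1, hsl]) w
    rw [h2] at h
    have h' := (Complex.le_def.1 (hτ' _ (sub_nonneg.2 h))).1
    rw [map_sub, hφ] at h'
    simpa using h'
  let y (w : A) (z : ℂ) : A := expSMul l z * w * expSMul l (-z)
  have hys (w : A) (z : ℂ) : star (y w z) = expSMul l (-star z) * star w * expSMul l (star z) := by
    simp only [y, star_mul, star_expSMul hl, star_neg, mul_assoc]
  -- Both edges of the strip.
  have hR (w : A) (z : ℂ) (hz : z.re = 1 / 4) : τ (star (y w z) * expSMul l (-1) * y w z) =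
      τ (star w * expSMul l (-(1 / 2)) * w * expSMul l (-(1 / 2))) := by
    have e1 : star z + -1 + z = -(1 / 2) := by
      apply Complex.ext
      · simp [hz]; norm_num
      · simp
    have e2 : -z + -star z = -(1 / 2) := by
      apply Complex.ext
      · simp [hz]; norm_num
      · simp
    have e : star (y w z) * expSMul l (-1) * y w z = expSMul l (-star z) *
        (star w * (expSMul l (star z) * expSMul l (-1) * expSMul l z) * w * expSMul l (-z)) := by
      rw [hys]; simp only [y, mul_assoc]
    rw [e, hτt, mul_assoc _ (expSMul l (-z)), ← expSMul_add, ← expSMul_add, ← expSMul_add, e1, e2]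
  -- The symmetric form is invariant under `w ↦ w⋆`, so `x` and `x⋆` both contribute `γ`.
  have hcyc (w : A) : τ (w * expSMul l (-(1 / 2)) * star w * expSMul l (-(1 / 2))) =
      τ (star w * expSMul l (-(1 / 2)) * w * expSMul l (-(1 / 2))) := by
    rw [mul_assoc (w * _), hτt, ← mul_assoc]
  have hL (w : A) (z : ℂ) (hz : z.re = -(1 / 4)) : τ (y w z * expSMul l (-1) * star (y w z)) =
      τ (star w * expSMul l (-(1 / 2)) * w * expSMul l (-(1 / 2))) := by
    have e1 : -z + -1 + -star z = -(1 / 2) := by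
      apply Complex.ext
      · simp [hz]; norm_num
      · simp
    have e2 : star z + z = -(1 / 2) := by
      apply Complex.ext
      · simp [hz]; norm_num
      · simp
    have e : y w z * expSMul l (-1) * star (y w z) = expSMul l z *
        (w * (expSMul l (-z) * expSMul l (-1) * expSMul l (-star z)) * star w *
          expSMul l (star z)) := by
      rw [hys]; simp only [y, mul_assoc]
    rw [e, hτt, mul_assoc _ (expSMul l (star z)), ← expSMul_add, ← expSMul_add, ← expSMul_add, e1,
      e2, hcyc]
  have hsw : τ (star (star x) * expSMul l (-(1 / 2)) * star x * expSMul l (-(1 / 2))) =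
      τ (star x * expSMul l (-(1 / 2)) * x * expSMul l (-(1 / 2))) := by
    rw [star_star, hcyc]
  -- The first factor uses `y (star x) z`, not `star (y x z)`, which would be antiholomorphic in
  -- `z`.
  let F (z : ℂ) : ℂ := τ' (φ (y (star x) z) * s * φ (y x z) * s)
  have hF0 : F 0 = τ' (star (φ x) * s * φ x * s) := by simp [F, y, map_star]
  have hyd (w : A) : Differentiable ℂ (y w) :=
    ((differentiable_expSMul l).mul_const w).mul
      ((differentiable_expSMul l).comp differentiable_neg)
  let φ' : A →L[ℂ] A' := ⟨φ.toLinearMap, hφc⟩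
  let τ'' : A' →L[ℂ] ℂ := ⟨τ', hτc⟩
  have hFd : Differentiable ℂ F := by
    have hd (w : A) : Differentiable ℂ fun z => φ (y w z) := φ'.differentiable.comp (hyd w)
    exact τ''.differentiable.comp ((((hd _).mul_const s).mul (hd _)).mul_const s)
  have hFr (z : ℂ) (hz : z.re = 1 / 4) : ‖F z‖ ≤ γ := by
    set u := y (star x) z
    set v := y x z
    have h := norm_trace_mul_le hτ' (s * φ u) (s * φ v)
    have e1 : τ' (s * φ u * (s * φ v)) = F z := by
      rw [mul_assoc, hτt', ← mul_assoc]
    have e2 : τ' (s * φ u * star (s * φ u)) = τ' (star (φ u) * (s * s) * φ u) := by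
      rw [hτt', star_mul, hs.star_eq]; simp only [mul_assoc]
    have e3 : star (s * φ v) * (s * φ v) = star (φ v) * (s * s) * φ v := by
      rw [star_mul, hs.star_eq]; simp only [mul_assoc]
    have hu := hQ u
    have hv := hQ v
    rw [hR _ _ hz, hsw] at hu
    rw [hR _ _ hz] at hv
    rw [e1, e2, e3] at h
    linarith
  -- Here each `s` is grouped to the right of its factor, so the one-sided inequality is applied to
  -- the adjoints of `u` and `v`.
  have hFl (z : ℂ) (hz : z.re = -(1 / 4)) : ‖F z‖ ≤ γ := by
    set u := y (star x) z
    set v := y x z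
    have h := norm_trace_mul_le hτ' (φ u * s) (φ v * s)
    have e1 : φ u * s * (φ v * s) = φ u * s * φ v * s := by simp only [mul_assoc]
    have e2 : φ u * s * star (φ u * s) = star (φ (star u)) * (s * s) * φ (star u) := by
      rw [star_mul, hs.star_eq, map_star, star_star]; simp only [mul_assoc]
    have e3 : τ' (star (φ v * s) * (φ v * s)) =
        τ' (star (φ (star v)) * (s * s) * φ (star v)) := by
      rw [hτt', star_mul, hs.star_eq, map_star, star_star]; simp only [mul_assoc]
    have hu := hQ (star u)
    have hv := hQ (star v)
    rw [star_star, hL _ _ hz, hsw] at hu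
    rw [star_star, hL _ _ hz] at hv
    rw [e1, e2, e3] at h
    linarith
  have hFb : ∃ C, ∀ z : ℂ, |z.re| ≤ 1 / 4 → ‖F z‖ ≤ C := by
    obtain ⟨C, hC⟩ := exists_norm_expSMul_le hl (1 / 4)
    have hb (w : A) (z : ℂ) (hz : |z.re| ≤ 1 / 4) : ‖φ (y w z)‖ ≤ ‖φ'‖ * (C * ‖w‖ * C) :=
      φ'.le_opNorm_of_le (norm_mul_le_of_le (norm_mul_le_of_le (hC z hz) le_rfl)
        (hC (-z) (by simpa using hz)))
    exact ⟨_, fun z hz => τ''.le_opNorm_of_le (norm_mul_le_of_le (norm_mul_le_of_le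
      (norm_mul_le_of_le (hb (star x) z hz) le_rfl) (hb x z hz)) le_rfl)⟩
  have key : ‖F 0‖ ≤ γ := by
    obtain ⟨C, hC⟩ := hFb
    -- `F` is bounded on the strip, so the growth condition holds with both constants zero.
    refine PhragmenLindelof.vertical_strip (a := -(1 / 4)) (b := 1 / 4) hFd.diffContOnCl
      ⟨0, by norm_num; positivity, 0, ?_⟩ hFl hFr (by norm_num) (by norm_num)
    refine Asymptotics.IsBigO.of_bound C ?_
    filter_upwards [Filter.mem_inf_of_right (Filter.mem_principal_self _)] with z hz
    have hz' : |z.re| ≤ 1 / 4 := abs_le.2 ⟨hz.1.le, hz.2.le⟩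
    simpa using hC z hz'
  rw [hF0] at key
  exact (Complex.re_le_norm _).trans key

end Contraction

/-! ### The 2-norm as a quadratic form, and the conclusion. -/

theorem CFC.rpow_abs_two {A : Type*} [CStarAlgebra A] [PartialOrder A] [StarOrderedRing A] (a : A) :
    CFC.rpow (CFC.abs a) 2 = star a * a := by
  have h := CFC.rpow_natCast (CFC.abs a) 2 (CFC.abs_nonneg a)
  rw [pow_two, CFC.abs_mul_abs] at h
  simpa [CFC.rpow_eq_pow] using h

theorem arakiMasudaNorm_two {H : Type*} [NormedAddCommGroup H] [InnerProductSpace ℂ H]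
    [CompleteSpace H] {M : VonNeumannAlgebra H} {τ : M.toStarSubalgebra →ₗ[ℂ] ℂ}
    (hτ : ∀ x y, τ (x * y) = τ (y * x)) {B : M.toStarSubalgebra} (hB : IsStrictlyPositive B)
    (X : M.toStarSubalgebra) :
    arakiMasudaNorm τ B 2 X = (τ (star X * CFC.rpow B (-(1 / 2)) * X *
      CFC.rpow B (-(1 / 2)))).re ^ (1 / 2 : ℝ) := by
  have hp : CFC.rpow B (-(1 / 2)) = CFC.rpow B (-(1 / 4)) * CFC.rpow B (-(1 / 4)) := by
    simp only [CFC.rpow_eq_pow, ← CFC.rpow_add hB.isUnit]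
    norm_num
  have hs : star (CFC.rpow B (-(1 / 4))) = CFC.rpow B (-(1 / 4)) :=
    (IsSelfAdjoint.of_nonneg CFC.rpow_nonneg).star_eq
  have hq : -(1 / (2 * Real.conjExponent 2)) = -(1 / 4) := by
    norm_num [Real.conjExponent]
  rw [arakiMasudaNorm, tracialNorm, hq, CFC.rpow_abs_two, hp]
  simp only [star_mul, hs]
  rw [mul_assoc, hτ]
  simp only [mul_assoc]

theorem mainTheorem4 {H K : Type*} [NormedAddCommGroup H] [InnerProductSpace ℂ H] [CompleteSpace H]
    [NormedAddCommGroup K] [InnerProductSpace ℂ K] [CompleteSpace K]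
    (M : VonNeumannAlgebra H) (N : VonNeumannAlgebra K)
    (τ : M.toStarSubalgebra →ₗ[ℂ] ℂ) (hτ : IsNormalFaithfulTracialState M τ)
    (τ' : N.toStarSubalgebra →ₗ[ℂ] ℂ) (hτ' : IsNormalFaithfulTracialState N τ')
    (φ : M.toStarSubalgebra →CP N.toStarSubalgebra) (hφ : IsStrictlyCPTP τ τ' φ)
    (B : M.toStarSubalgebra) (hB : 0 ≤ B) (hBu : IsUnit B) (hB1 : τ B = 1)
    (X : M.toStarSubalgebra) :
    arakiMasudaNorm τ' (φ B) 2 (φ X) ≤ arakiMasudaNorm τ B 2 X := by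
  obtain ⟨hS, hSu⟩ := hφ.strict B hB hBu
  have hBp : IsStrictlyPositive B := IsStrictlyPositive.iff_of_unital.2 ⟨hB, hBu⟩
  have hSp : IsStrictlyPositive (φ B) := IsStrictlyPositive.iff_of_unital.2 ⟨hS, hSu⟩
  have hs : IsSelfAdjoint (CFC.rpow (φ B) (-(1 / 2))) := .of_nonneg CFC.rpow_nonneg
  rw [arakiMasudaNorm_two hτ'.tracial hSp, arakiMasudaNorm_two hτ.tracial hBp]
  refine Real.rpow_le_rpow ?_ ?_ (by norm_num)
  · have hq : IsSelfAdjoint (CFC.rpow (φ B) (-(1 / 4))) := .of_nonneg CFC.rpow_nonneg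
    have h2 : CFC.rpow (φ B) (-(1 / 2)) =
        CFC.rpow (φ B) (-(1 / 4)) * CFC.rpow (φ B) (-(1 / 4)) := by
      simp only [CFC.rpow_eq_pow, ← CFC.rpow_add hSu]
      norm_num
    have h := (Complex.le_def.1 (hτ'.nonneg _ (star_mul_self_nonneg
      (CFC.rpow (φ B) (-(1 / 4)) * φ X * CFC.rpow (φ B) (-(1 / 4)))))).1
    rw [star_mul, star_mul, hq.star_eq, mul_assoc, hτ'.tracial] at h
    simpa only [h2, mul_assoc, Complex.zero_re] using h
  · have he : expSMul (CFC.log B) 1 = B := by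
      simp [expSMul, CFC.exp_log B hBp]
    have hr : CFC.rpow B (-(1 / 2)) = expSMul (CFC.log B) (-(1 / 2)) := by
      rw [CFC.rpow_eq_expSMul_log hBp]
      norm_num
    rw [hr]
    refine re_trace_le_of_expSMul hτ.tracial hτ'.nonneg hτ'.tracial φ hφ.trace_preserving
      IsSelfAdjoint.log hs ?_ X
    rw [he, CFC.rpow_eq_pow, ← CFC.rpow_add hSu]
    have h1 : (-(1 / 2) + -(1 / 2) : ℝ) = -1 := by norm_num
    rw [h1]
    nth_rewrite 2 [← CFC.rpow_one (φ B) hS]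
    exact CFC.rpow_neg_mul_rpow 1 hSp
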